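/- Let $G$ be a first-order expansion of a group, that is, a structure in a first-order language $\mathcal L$ (of any cardinality) that has a binary function symbol interpreted in $G$ as the multiplication of a group. Let $T$ be the complete theory of $G$, and let $\mathbb G$ be a $|G|^+$-saturated elementary extension of $G$, with $\cdot$ interpreted in $\mathbb G$ by the same function symbol. For a formula $\varphi(x)$ in a single variable with parameters from $G$, write $\varphi(G)=\{g\in G : G\models\varphi(g)\}$. - $\varphi(x)$ has the *productset property* if there are infinite sets $B,C\subseteq G$ such that $B\cdot C\subseteq\varphi(G)$. - $\varphi(x)$ is *coheir substantial* if there are $b,c\in\mathbb G\setminus G$ such that $\mathbb G\models\varphi(b\cdot c)$ and such that both $\mathrm{tp}(b/G\cup\{c\})$ and $\mathrm{tp}(c/G\cup\{b\})$ are finitely satisfiable in $G$ (each finite set of formulas in the type is realized by an element of $G$). - $T$ is *stable* if no $\mathcal L$-formula $\psi(\bar x,\bar y)$ has the order property, i.e. there are no model $M\models T$ and tuples $(\bar a_i)_{i<\omega}$, $(\bar b_j)_{j<\omega}$ in $M$ such that $M\models\psi(\bar a_i,\bar b_j)$ if and only if $i<j$. **Theorem.** Let $\varphi(x)$ be a formula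 in a single variable with parameters from $G$. (a) If $\varphi(x)$ is coheir substantial, then $\varphi(x)$ has the productset property. (b) Assume that $T$ is stable. Then $\varphi(x)$ is coheir substantial if and only if it has the productset property. -/

import Mathlib

open FirstOrder Cardinal
open scoped Pointwise

universe u v w w'

namespace Productset

/-- A subset `A` of a group has the productset property if `B * C ⊆ A` for some infinite sets
`B` and `C`. -/
def HasProductsetProperty {G : Type w} [Group G] (A : Set G) : Prop :=
  ∃ B C : Set G, B.Infinite ∧ C.Infinite ∧ B * C ⊆ A

section ModelTheory

variable {L : FirstOrder.Language.{u, v}}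

/-- The `L`-structure `G` is an expansion of the group `G`, the binary function symbol `mul` of
`L` being the symbol for the group multiplication. -/
def IsGroupExpansion (mul : L.Functions 2) (G : Type w) [Group G] [L.Structure G] : Prop :=
  ∀ a b : G, FirstOrder.Language.Structure.funMap mul ![a, b] = a * b

/-- The interpretation in an `L`-structure `M` of the binary function symbol `mul`. -/
def mulIn (mul : L.Functions 2) {M : Type w} [L.Structure M] (x y : M) : M :=
  FirstOrder.Language.Structure.funMap mul ![x, y]

/-- Formulas in a single variable with parameters from `A`: the free variables of an `L`-formula
are the elements of `A`, each to be replaced by the parameter that it names, and one variable.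
(These correspond to the formulas `L[[A]].Formula (Fin 1)` by `BoundedFormula.constantsVarsEquiv`.)
-/
abbrev FormulaOver (L : FirstOrder.Language.{u, v}) (A : Type w) : Type (max u v w) :=
  L.Formula (A ⊕ Fin 1)

/-- `φ(x)` holds in `M`, where the parameters `a ∈ A` of `φ` are interpreted as the elements `i a`
of `M`. -/
def Holds {A : Type w} {M : Type w'} [L.Structure M] (i : A → M) (φ : FormulaOver L A) (x : M) :
    Prop :=
  φ.Realize (Sum.elim i (fun _ => x))

/-- The set `φ(G)` defined in `G` by a formula `φ(x)` with parameters from `G`. -/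
def solutionSet {G : Type w} [L.Structure G] (φ : FormulaOver L G) : Set G :=
  {g | Holds id φ g}

/-- The set `p(x)` of formulas with parameters from `A ⊆ M` is finitely satisfiable in `B ⊆ M`:
each finite subset of `p(x)` is realized in `M` by an element of `B`. -/
def FinitelySatisfiableIn {M : Type w} [L.Structure M] {A : Set M} (p : Set (FormulaOver L A))
    (B : Set M) : Prop :=
  ∀ F : Set (FormulaOver L A), F.Finite → F ⊆ p →
    ∃ b ∈ B, ∀ ψ ∈ F, Holds (Subtype.val : A → M) ψ b

/-- `tp(b/A)`, the complete type of the element `b` of `M` over `A ⊆ M`. -/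
def tp (L : FirstOrder.Language.{u, v}) {M : Type w} [L.Structure M] (b : M) (A : Set M) :
    Set (FormulaOver L A) :=
  {ψ | Holds (Subtype.val : A → M) ψ b}

/-- `M` is `κ`-saturated: if `A ⊆ M` has fewer than `κ` elements, then every 1-type over `A` (that
is, every set of formulas in one variable over `A` that is finitely satisfiable in `M`) is realized
in `M`. -/
def IsSaturated (L : FirstOrder.Language.{u, v}) (M : Type w) [L.Structure M] (κ : Cardinal.{w}) : Prop :=
  ∀ A : Set M, #A < κ → ∀ p : Set (FormulaOver L A), FinitelySatisfiableIn p Set.univ →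
    ∃ x : M, ∀ ψ ∈ p, Holds (Subtype.val : A → M) ψ x

/-- The subset `A` of `M` is small: `M` is `|A|⁺`-saturated. -/
def IsSmall (L : FirstOrder.Language.{u, v}) {M : Type w} [L.Structure M] (A : Set M) : Prop :=
  IsSaturated L M (Order.succ #A)

/-- The formula `φ(x̄; ȳ)` has the order property with respect to the theory `T`: in some model of
`T` there are tuples `a_i`, `b_j` for which `φ(a_i; b_j)` holds if and only if `i < j`. -/
def HasOrderProperty (T : L.Theory) {m n : ℕ} (φ : L.Formula (Fin m ⊕ Fin n)) : Prop :=
  ∃ (M : FirstOrder.Language.Theory.ModelType.{u, v, max u v} T) (a : ℕ → Fin m → M) (b : ℕ → Fin n → M),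
    ∀ i j : ℕ, φ.Realize (Sum.elim (a i) (b j)) ↔ i < j

/-- The theory `T` is stable: no formula has the order property with respect to `T`. -/
def IsStable (T : L.Theory) : Prop :=
  ∀ (m n : ℕ) (φ : L.Formula (Fin m ⊕ Fin n)), ¬ HasOrderProperty T φ

/-- The formula `φ(x)` with parameters from `G` is coheir substantial, with respect to the
elementary extension `N` of `G` given by the embedding `f`: there are `b, c ∈ N \ G` such that
`φ(b · c)` holds and `tp(b/Gc)` and `tp(c/Gb)` are finitely satisfiable in `G`. -/
def IsCoheirSubstantial (mul : L.Functions 2) {G : Type w} [L.Structure G] {N : Type w'}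
    [L.Structure N] (f : G ↪ₑ[L] N) (φ : FormulaOver L G) : Prop :=
  ∃ b c : N, b ∉ Set.range f ∧ c ∉ Set.range f ∧ Holds f φ (mulIn mul b c) ∧
    FinitelySatisfiableIn (tp L b (insert c (Set.range f))) (Set.range f) ∧
    FinitelySatisfiableIn (tp L c (insert b (Set.range f))) (Set.range f)

end ModelTheory

end Productset

namespace Productset

open FirstOrder.Language Filter

variable {L : FirstOrder.Language.{u, v}}

/-! Finite satisfiability in `G` is read as being a limit: `b` is approached over its parameters by
elements of `G` along a proper filter. For (a), a pair `(b, c)` with each element a limit over the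
other lets `B` and `C` be built by alternation, choosing elements of `G` that imitate `b` and `c`.
For the converse in (b), ultrafilters on `G` concentrating on `B` and `C` have limits `b` over `G`
and `c` over `G ∪ {b}`. Only the finite satisfiability of `tp(b/Gc)` is then in doubt; it amounts to
exchanging two ultrafilter quantifiers (`IsStable.eventually_swap`), whose failure would produce the
order property. -/

/-! ### Descent of the order property to finite tuples and small models. -/

section OrderProperty

/-- Every small subset of a structure is contained in a small elementary substructure. -/
theorem exists_small_elementarySubstructure_superset {M : Type w} [Nonempty M] [L.Structure M]
    (s : Set M) [Small.{max u v} s] :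
    ∃ S : L.ElementarySubstructure M, s ⊆ S ∧ Small.{max u v} S :=
  ⟨(Substructure.closure (L.sum L.skolem₁) s).elementarySkolem₁Reduct,
    Substructure.subset_closure,
    (inferInstance : Small.{max u v} (Substructure.closure (L.sum L.skolem₁) s))⟩

/-- The order property can be witnessed in a model of any universe, and by tuples indexed by
arbitrary types of variables. -/
theorem HasOrderProperty.exists_of_realize {T : L.Theory} {M : Type w} [L.Structure M] [Nonempty M]
    [M ⊨ T] {α β : Type*} (φ : L.Formula (α ⊕ β)) (a : ℕ → α → M) (b : ℕ → β → M)
    (h : ∀ i j, φ.Realize (Sum.elim (a i) (b j)) ↔ i < j) :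
    ∃ (m n : ℕ) (ψ : L.Formula (Fin m ⊕ Fin n)), HasOrderProperty T ψ := by
  classical
  set k := φ.freeVarFinset.card
  let e : φ.freeVarFinset ≃ Fin k := φ.freeVarFinset.equivFin
  let g : φ.freeVarFinset → Fin k ⊕ Fin k := fun x =>
    Sum.elim (fun _ => Sum.inl (e x)) (fun _ => Sum.inr (e x)) x.1
  -- Each tuple has a coordinate for every free variable of `φ`. Those belonging to the other side
  -- are filled with `b 0` or `a 0`, and `g` never reads them.
  let a' : ℕ → Fin k → M := fun i l => Sum.elim (a i) (b 0) (e.symm l).1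
  let b' : ℕ → Fin k → M := fun j l => Sum.elim (a 0) (b j) (e.symm l).1
  obtain ⟨S, hsS, hS⟩ := exists_small_elementarySubstructure_superset (L := L)
    (Set.range (fun x : ℕ × Fin k => a' x.1 x.2) ∪ Set.range (fun x : ℕ × Fin k => b' x.1 x.2))
  have ha : ∀ i l, a' i l ∈ S := fun i l => hsS (Or.inl ⟨(i, l), rfl⟩)
  have hb : ∀ i l, b' i l ∈ S := fun i l => hsS (Or.inr ⟨(i, l), rfl⟩)
  let E : S ≃ Shrink.{max u v} S := equivShrink S
  let _ := E.inducedStructure (L := L)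
  let EL : S ≃[L] Shrink.{max u v} S := E.inducedStructureEquiv
  have : Nonempty (Shrink.{max u v} S) := E.symm.nonempty
  have : Shrink.{max u v} S ⊨ T := StrongHomClass.theory_model EL
  refine ⟨k, k, φ.restrictFreeVar g, Theory.ModelType.of T (Shrink.{max u v} S),
    fun i l => EL ⟨a' i l, ha i l⟩, fun j l => EL ⟨b' j l, hb j l⟩, fun i j => ?_⟩
  rw [← h i j]
  have h1 : (Sum.elim (fun l => EL ⟨a' i l, ha i l⟩) (fun l => EL ⟨b' j l, hb j l⟩) :
      Fin k ⊕ Fin k → Shrink.{max u v} S) =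
      EL ∘ Sum.elim (fun l => ⟨a' i l, ha i l⟩) (fun l => ⟨b' j l, hb j l⟩) := by
    ext x; cases x <;> rfl
  have h2 := StrongHomClass.realize_formula EL (φ.restrictFreeVar g)
    (v := Sum.elim (fun l => ⟨a' i l, ha i l⟩) (fun l => ⟨b' j l, hb j l⟩))
  rw [← h1] at h2
  refine h2.trans ((S.subtype.map_formula _ _).symm.trans
    (BoundedFormula.realize_restrictFreeVar _ ?_))
  rintro ⟨x | x, hx⟩ <;> simp [g, a', b']

end OrderProperty

/-! ### Limits of filters on `G`. -/

section Limits

/-- The type `tp(b/A)` consists of formulas that hold at `f g` for all `g` in some set of the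
filter `l`. -/
def IsLimit (L : FirstOrder.Language.{u, v}) {G : Type w} {N : Type w'} [L.Structure N]
    (f : G → N) (A : Set N) (l : Filter G) (b : N) : Prop :=
  ∀ ψ : FormulaOver L A, Holds Subtype.val ψ b → ∀ᶠ g in l, Holds Subtype.val ψ (f g)

variable {G : Type w} {N : Type w'} [L.Structure N]

theorem IsLimit.finitelySatisfiableIn {f : G → N} {A : Set N} {l : Filter G} [l.NeBot] {b : N}
    (h : IsLimit L f A l b) : FinitelySatisfiableIn (tp L b A) (Set.range f) := by
  intro F hF hFp
  obtain ⟨g, hg⟩ := ((eventually_all_finite hF).2 fun ψ hψ => h ψ (hFp hψ)).exists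
  exact ⟨f g, ⟨g, rfl⟩, hg⟩

/-- The traces on `G` of the formulas in the type have the finite intersection property, so they
generate a proper filter. -/
theorem FinitelySatisfiableIn.exists_isLimit {f : G → N} {A : Set N} {b : N}
    (h : FinitelySatisfiableIn (tp L b A) (Set.range f)) :
    ∃ l : Filter G, l.NeBot ∧ IsLimit L f A l b := by
  let D : FormulaOver L A → Set G := fun ψ => {g | Holds Subtype.val ψ (f g)}
  refine ⟨generate (D '' tp L b A), generate_neBot_iff.2 fun t ht htf => ?_,
    fun ψ hψ => GenerateSets.basic ⟨ψ, hψ, rfl⟩⟩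
  obtain ⟨F, hFp, hF, rfl⟩ :=
    Set.exists_subset_image_finite_and.1 ⟨t, ht, htf, (rfl : t = t)⟩
  obtain ⟨_, ⟨g, rfl⟩, hg⟩ := h F hF hFp
  exact ⟨g, by rintro _ ⟨ψ, hψ, rfl⟩; exact hg ψ hψ⟩

theorem IsLimit.iff {f : G → N} {A : Set N} {U : Ultrafilter G} {b : N}
    (h : IsLimit L f A U b) (ψ : FormulaOver L A) :
    Holds Subtype.val ψ b ↔ ∀ᶠ g in U, Holds Subtype.val ψ (f g) := by
  refine ⟨h ψ, fun hU => by_contra fun hb => ?_⟩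
  obtain ⟨g, hg, hg'⟩ := (hU.and (h ψ.not hb)).exists
  exact hg' hg

/-- An ultrafilter on `G` has a limit over each set over which types are realized. -/
theorem exists_isLimit (f : G → N) {A : Set N} (hN : IsSmall L (Set.range f))
    (hA : #A ≤ #(Set.range f)) (U : Ultrafilter G) : ∃ b : N, IsLimit L f A U b := by
  obtain ⟨b, hb⟩ := hN A (Order.lt_succ_of_le hA)
    {ψ | ∀ᶠ g in U, Holds Subtype.val ψ (f g)} fun F hF hFp => by
      obtain ⟨g, hg⟩ := ((eventually_all_finite hF).2 hFp).exists
      exact ⟨f g, trivial, hg⟩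
  refine ⟨b, fun ψ hψ => ?_⟩
  by_contra hU
  exact hb ψ.not (Ultrafilter.eventually_not.2 hU) hψ

theorem IsLimit.eventually_ne {f : G → N} {A : Set N} {l : Filter G} {b a : N}
    (h : IsLimit L f A l b) (ha : a ∈ A) (hba : b ≠ a) : ∀ᶠ g in l, f g ≠ a := by
  let ψ : FormulaOver L A :=
    (Term.equal (Term.var (Sum.inr 0)) (Term.var (Sum.inl ⟨a, ha⟩))).not
  have hψ : ∀ x : N, Holds Subtype.val ψ x ↔ x ≠ a := fun x => by
    simp [Holds, ψ, Formula.Realize, Term.equal]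
  exact (h ψ ((hψ b).2 hba)).mono fun g hg => (hψ _).1 hg

/-- The formula `θ(x, y)` over `G` with `y` replaced by an element of `A`, as a formula over `A`. -/
theorem exists_formulaOver_left (f : G → N) {A : Set N} (hf : Set.range f ⊆ A)
    (θ : L.Formula (G ⊕ Fin 2)) {y : N} (hy : y ∈ A) :
    ∃ ψ : FormulaOver L A, ∀ x, Holds Subtype.val ψ x ↔ θ.Realize (Sum.elim f ![x, y]) := by
  refine ⟨θ.relabel (Sum.elim (fun g => Sum.inl ⟨f g, hf ⟨g, rfl⟩⟩) ![Sum.inr 0, Sum.inl ⟨y, hy⟩]),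
    fun x => ?_⟩
  rw [Holds, Formula.realize_relabel]
  refine iff_of_eq (congrArg _ (funext fun i => ?_))
  rcases i with g | i
  · rfl
  · fin_cases i <;> rfl

/-- The formula `θ(x, y)` over `G` with `x` replaced by an element of `A`, as a formula over `A`. -/
theorem exists_formulaOver_right (f : G → N) {A : Set N} (hf : Set.range f ⊆ A)
    (θ : L.Formula (G ⊕ Fin 2)) {x : N} (hx : x ∈ A) :
    ∃ ψ : FormulaOver L A, ∀ y, Holds Subtype.val ψ y ↔ θ.Realize (Sum.elim f ![x, y]) := by
  refine ⟨θ.relabel (Sum.elim (fun g => Sum.inl ⟨f g, hf ⟨g, rfl⟩⟩) ![Sum.inl ⟨x, hx⟩, Sum.inr 0]),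
    fun y => ?_⟩
  rw [Holds, Formula.realize_relabel]
  refine iff_of_eq (congrArg _ (funext fun i => ?_))
  rcases i with g | i
  · rfl
  · fin_cases i <;> rfl

/-- Each formula over `G ∪ {y}` is `θ(x, y)` for some formula `θ` over `G`. -/
theorem exists_formula_pair (f : G → N) {c : N} (ψ : FormulaOver L ↥(insert c (Set.range f))) :
    ∃ θ : L.Formula (G ⊕ Fin 2),
      ∀ x, Holds Subtype.val ψ x ↔ θ.Realize (Sum.elim f ![x, c]) := by
  have key : ∀ a : ↥(insert c (Set.range f)), ∃ i : G ⊕ Fin 2,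
      ∀ x, (Sum.elim f ![x, c] : G ⊕ Fin 2 → N) i = a := by
    rintro ⟨a, rfl | ⟨g, rfl⟩⟩
    · exact ⟨Sum.inr 1, fun x => rfl⟩
    · exact ⟨Sum.inl g, fun x => rfl⟩
  choose r hr using key
  refine ⟨ψ.relabel (Sum.elim r fun _ => Sum.inr 0), fun x => ?_⟩
  rw [Holds, Formula.realize_relabel]
  refine iff_of_eq (congrArg _ (funext fun i => ?_))
  rcases i with a | i
  · exact (hr a x).symm
  · rfl

theorem IsLimit.eventually_left {f : G → N} {A : Set N} {l : Filter G} {b : N}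
    (h : IsLimit L f A l b) (hf : Set.range f ⊆ A) (θ : L.Formula (G ⊕ Fin 2)) {y : N} (hy : y ∈ A)
    (hb : θ.Realize (Sum.elim f ![b, y])) : ∀ᶠ g in l, θ.Realize (Sum.elim f ![f g, y]) := by
  obtain ⟨ψ, hψ⟩ := exists_formulaOver_left f hf θ hy
  exact (h ψ ((hψ b).2 hb)).mono fun g => (hψ _).1

theorem IsLimit.eventually_right {f : G → N} {A : Set N} {l : Filter G} {c : N}
    (h : IsLimit L f A l c) (hf : Set.range f ⊆ A) (θ : L.Formula (G ⊕ Fin 2)) {x : N} (hx : x ∈ A)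
    (hc : θ.Realize (Sum.elim f ![x, c])) : ∀ᶠ g in l, θ.Realize (Sum.elim f ![x, f g]) := by
  obtain ⟨ψ, hψ⟩ := exists_formulaOver_right f hf θ hx
  exact (h ψ ((hψ c).2 hc)).mono fun g => (hψ _).1

theorem IsLimit.left_iff {f : G → N} {A : Set N} {U : Ultrafilter G} {b : N}
    (h : IsLimit L f A U b) (hf : Set.range f ⊆ A) (θ : L.Formula (G ⊕ Fin 2)) {y : N}
    (hy : y ∈ A) :
    θ.Realize (Sum.elim f ![b, y]) ↔ ∀ᶠ g in U, θ.Realize (Sum.elim f ![f g, y]) := by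
  obtain ⟨ψ, hψ⟩ := exists_formulaOver_left f hf θ hy
  simpa only [hψ] using h.iff ψ

theorem IsLimit.right_iff {f : G → N} {A : Set N} {U : Ultrafilter G} {c : N}
    (h : IsLimit L f A U c) (hf : Set.range f ⊆ A) (θ : L.Formula (G ⊕ Fin 2)) {x : N}
    (hx : x ∈ A) :
    θ.Realize (Sum.elim f ![x, c]) ↔ ∀ᶠ g in U, θ.Realize (Sum.elim f ![x, f g]) := by
  obtain ⟨ψ, hψ⟩ := exists_formulaOver_right f hf θ hx
  simpa only [hψ] using h.iff ψ

theorem realize_pair_iff [L.Structure G] (f : G ↪ₑ[L] N) (θ : L.Formula (G ⊕ Fin 2)) (x y : G) :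
    θ.Realize (Sum.elim f ![f x, f y]) ↔ θ.Realize (Sum.elim id ![x, y]) := by
  rw [← f.map_formula]
  refine iff_of_eq (congrArg _ (funext fun i => ?_))
  rcases i with g | i
  · rfl
  · fin_cases i <;> rfl

/-- The formula `φ(x · y)`. -/
theorem exists_formula_mul (f : G → N) (mul : L.Functions 2) (φ : FormulaOver L G) :
    ∃ θ : L.Formula (G ⊕ Fin 2), ∀ x y : N,
      θ.Realize (Sum.elim f ![x, y]) ↔ Holds f φ (mulIn mul x y) := by
  refine ⟨BoundedFormula.subst φ (Sum.elim (fun g => Term.var (Sum.inl g))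
    fun _ => mul.apply₂ (Term.var (Sum.inr 0)) (Term.var (Sum.inr 1))), fun x y => ?_⟩
  rw [Holds, Formula.Realize, BoundedFormula.realize_subst, Formula.Realize]
  refine iff_of_eq (congrArg (fun v => BoundedFormula.Realize φ v _) (funext fun k => ?_))
  rcases k with g | k
  · rfl
  · simp [mulIn]

theorem IsLimit.not_mem_range {f : G → N} (hf : Function.Injective f) {A : Set N}
    (hA : Set.range f ⊆ A) {U : Ultrafilter G} (hU : (U : Filter G) ≤ cofinite) {b : N}
    (h : IsLimit L f A U b) : b ∉ Set.range f := by
  rintro ⟨g, rfl⟩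
  let ψ : FormulaOver L A :=
    Term.equal (Term.var (Sum.inr 0)) (Term.var (Sum.inl ⟨f g, hA ⟨g, rfl⟩⟩))
  have hψ : ∀ x : N, Holds Subtype.val ψ x ↔ x = f g := fun x => by
    simp [Holds, ψ, Formula.Realize, Term.equal]
  obtain ⟨x, hx, hx'⟩ := ((h ψ ((hψ _).2 rfl)).and (hU (eventually_cofinite_ne g))).exists
  exact hx' (hf ((hψ _).1 hx))

end Limits

/-! ### Exchange of ultrafilter limits in a stable theory. -/

section Stability

variable {G : Type w} [L.Structure G] [Nonempty G]

/-- In a stable theory, limits along two ultrafilters commute (one implication). -/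
theorem IsStable.eventually_swap (hT : IsStable (L.completeTheory G)) (θ : L.Formula (G ⊕ Fin 2))
    (U V : Ultrafilter G)
    (h : ∀ᶠ y in V, ∀ᶠ x in U, θ.Realize (Sum.elim id ![x, y])) :
    ∀ᶠ x in U, ∀ᶠ y in V, θ.Realize (Sum.elim id ![x, y]) := by
  by_contra hU
  rw [← Ultrafilter.eventually_not] at hU
  simp only [← Ultrafilter.eventually_not] at hU
  obtain ⟨s, hs, hs'⟩ := exists_seq_of_forall_finset_exists
    (fun z : G × G => (∀ᶠ y in V, ¬ θ.Realize (Sum.elim id ![z.1, y])) ∧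
      (∀ᶠ x in U, θ.Realize (Sum.elim id ![x, z.2])) ∧ ¬ θ.Realize (Sum.elim id ![z.1, z.2]))
    (fun z z' => θ.Realize (Sum.elim id ![z'.1, z.2]) ∧ ¬ θ.Realize (Sum.elim id ![z.1, z'.2]))
    -- The new `x` satisfies `θ` with all earlier second coordinates; the new `y` fails it with all
    -- earlier first coordinates and with `x` itself, which makes the order strict.
    fun F hF => by
      obtain ⟨x, hx, hxF⟩ :=
        (hU.and ((eventually_all_finset F).2 fun z hz => (hF z hz).2.1)).exists
      obtain ⟨y, ⟨hy, hxy⟩, hyF⟩ :=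
        ((h.and hx).and ((eventually_all_finset F).2 fun z hz => (hF z hz).1)).exists
      exact ⟨(x, y), ⟨hx, hy, hxy⟩, fun z hz => ⟨hxF z hz, hyF z hz⟩⟩
  have hiff : ∀ i j, θ.Realize (Sum.elim id ![(s j).1, (s i).2]) ↔ i < j := fun i j => by
    rcases lt_trichotomy i j with hij | rfl | hij
    · exact iff_of_true (hs' i j hij).1 hij
    · exact iff_of_false (hs i).2.2 (lt_irrefl i)
    · exact iff_of_false (hs' j i hij).2 hij.not_gt
  -- The parameters from `G` join the second tuple, with the same values at every index.
  obtain ⟨m, n, ψ, hψ⟩ := HasOrderProperty.exists_of_realize (T := L.completeTheory G)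
    (θ.relabel (Sum.elim (fun g => Sum.inr (Sum.inl g)) ![Sum.inr (Sum.inr 0), Sum.inl 0]) :
      L.Formula (Fin 1 ⊕ (G ⊕ Fin 1)))
    (fun i _ => (s i).2) (fun j => Sum.elim id fun _ => (s j).1) fun i j => by
      rw [← hiff i j, Formula.realize_relabel]
      refine iff_of_eq (congrArg _ (funext fun k => ?_))
      rcases k with g | k
      · rfl
      · fin_cases k <;> rfl
  exact hT m n ψ hψ

end Stability

/-! ### The two implications. -/

section Main

variable {G : Type w} [Group G] [L.Structure G] {N : Type w'} [L.Structure N]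

theorem holds_mulIn_iff {mul : L.Functions 2} (hmul : IsGroupExpansion mul G) (f : G ↪ₑ[L] N)
    (φ : FormulaOver L G) (x y : G) :
    Holds f φ (mulIn mul (f x) (f y)) ↔ x * y ∈ solutionSet φ := by
  have hf : mulIn mul (f x) (f y) = f (x * y) := by
    rw [← hmul x y, f.map_fun, mulIn]
    congr 1
    ext i
    fin_cases i <;> rfl
  change _ ↔ φ.Realize (Sum.elim id fun _ => x * y)
  rw [hf, Holds, ← f.map_formula]
  refine iff_of_eq (congrArg _ (funext fun k => ?_))
  rcases k with g | k <;> rfl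

theorem infinite_range_of_ne {α : Type*} {s : ℕ → α} (h : ∀ m n, m < n → s m ≠ s n) :
    (Set.range s).Infinite :=
  Set.infinite_range_of_injective fun m n hmn => by
    rcases lt_trichotomy m n with hlt | heq | hlt
    · exact absurd hmn (h m n hlt)
    · exact heq
    · exact absurd hmn.symm (h n m hlt)

theorem IsCoheirSubstantial.hasProductsetProperty {mul : L.Functions 2}
    (hmul : IsGroupExpansion mul G) {f : G ↪ₑ[L] N} {φ : FormulaOver L G}
    (h : IsCoheirSubstantial mul f φ) : HasProductsetProperty (solutionSet φ) := by
  obtain ⟨b, c, hb, hc, hbc, hbt, hct⟩ := h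
  obtain ⟨l, _, hl⟩ := hbt.exists_isLimit
  obtain ⟨k, _, hk⟩ := hct.exists_isLimit
  obtain ⟨θ, hθ⟩ := exists_formula_mul f mul φ
  have hG : ∀ x y : G, θ.Realize (Sum.elim f ![f x, f y]) ↔ x * y ∈ solutionSet φ := fun x y =>
    (hθ _ _).trans (holds_mulIn_iff hmul f φ x y)
  rw [← hθ] at hbc
  have hlc := hl.eventually_left (Set.subset_insert _ _) θ (Set.mem_insert _ _) hbc
  have hkb := hk.eventually_right (Set.subset_insert _ _) θ (Set.mem_insert _ _) hbc
  -- Keeping `θ(x, c)` and `θ(b, y)` true for each chosen pair is what allows later elements, close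
  -- to `b` or `c`, to multiply correctly with it.
  obtain ⟨s, hs, hs'⟩ := exists_seq_of_forall_finset_exists
    (fun z : G × G => θ.Realize (Sum.elim f ![f z.1, c]) ∧ θ.Realize (Sum.elim f ![b, f z.2]) ∧
      z.1 * z.2 ∈ solutionSet φ)
    (fun z z' => (z.1 * z'.2 ∈ solutionSet φ ∧ z'.1 * z.2 ∈ solutionSet φ) ∧
      z.1 ≠ z'.1 ∧ z.2 ≠ z'.2)
    fun F hF => by
      obtain ⟨x, hxc, hxF⟩ := (hlc.and ((eventually_all_finset F).2 fun z hz =>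
        (hl.eventually_left (Set.subset_insert _ _) θ (Set.mem_insert_of_mem _ ⟨z.2, rfl⟩)
          (hF z hz).2.1).and (hl.eventually_ne (Set.mem_insert_of_mem _ ⟨z.1, rfl⟩)
            fun h => hb ⟨z.1, h.symm⟩))).exists
      obtain ⟨y, ⟨hyb, hxy⟩, hyF⟩ := ((hkb.and (hk.eventually_right (Set.subset_insert _ _) θ
        (Set.mem_insert_of_mem _ ⟨x, rfl⟩) hxc)).and ((eventually_all_finset F).2 fun z hz =>
        (hk.eventually_right (Set.subset_insert _ _) θ (Set.mem_insert_of_mem _ ⟨z.1, rfl⟩)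
          (hF z hz).1).and (hk.eventually_ne (Set.mem_insert_of_mem _ ⟨z.2, rfl⟩)
            fun h => hc ⟨z.2, h.symm⟩))).exists
      refine ⟨(x, y), ⟨hxc, hyb, (hG _ _).1 hxy⟩, fun z hz =>
        ⟨⟨(hG _ _).1 (hyF z hz).1, (hG _ _).1 (hxF z hz).1⟩, ?_, ?_⟩⟩
      · rintro rfl
        exact (hxF z hz).2 rfl
      · rintro rfl
        exact (hyF z hz).2 rfl
  refine ⟨Set.range fun n => (s n).1, Set.range fun n => (s n).2,
    infinite_range_of_ne fun m n hmn => (hs' m n hmn).2.1,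
    infinite_range_of_ne fun m n hmn => (hs' m n hmn).2.2, ?_⟩
  rintro _ ⟨_, ⟨m, rfl⟩, _, ⟨n, rfl⟩, rfl⟩
  rcases lt_trichotomy m n with hmn | rfl | hmn
  · exact (hs' m n hmn).1.1
  · exact (hs m).2.2
  · exact (hs' n m hmn).1.2

theorem HasProductsetProperty.isCoheirSubstantial {mul : L.Functions 2}
    (hmul : IsGroupExpansion mul G) {f : G ↪ₑ[L] N} (hN : IsSmall L (Set.range f))
    (hT : IsStable (L.completeTheory G)) {φ : FormulaOver L G}
    (h : HasProductsetProperty (solutionSet φ)) : IsCoheirSubstantial mul f φ := by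
  obtain ⟨B, C, hB, hC, hBC⟩ := h
  have key : ∀ S : Set G, S.Infinite →
      ∃ U : Ultrafilter G, (U : Filter G) ≤ cofinite ∧ ∀ᶠ g in U, g ∈ S := fun S hS => by
    have : (cofinite ⊓ 𝓟 S).NeBot := hS.cofinite_inf_principal_neBot
    exact ⟨Ultrafilter.of (cofinite ⊓ 𝓟 S), (Ultrafilter.of_le _).trans inf_le_left,
      (Ultrafilter.of_le _).trans inf_le_right (mem_principal_self S)⟩
  obtain ⟨U, hU, hUB⟩ := key B hB
  obtain ⟨V, hV, hVC⟩ := key C hC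
  -- Infinitude ensures that adding `b` to the parameters does not raise their cardinality.
  have : Infinite (Set.range f) := by
    have : Infinite G := Set.infinite_univ_iff.1 (hB.mono (Set.subset_univ B))
    exact (Set.infinite_range_of_injective f.injective).to_subtype
  obtain ⟨b, hb⟩ := exists_isLimit f hN le_rfl U
  obtain ⟨c, hc⟩ := exists_isLimit (A := insert b (Set.range f)) f hN
    (mk_insert_le.trans (add_one_eq (aleph0_le_mk _)).le) V
  -- From `θ(b, c)` follows `θ(x, y)` for `V`-most `y` and then `U`-most `x`; after the exchange,
  -- `θ(x, c)` holds for `U`-most `x`.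
  have hb' : IsLimit L f (insert c (Set.range f)) U b := fun ψ hψ => by
    obtain ⟨θ, hθ⟩ := exists_formula_pair f ψ
    simp only [hθ] at hψ ⊢
    rw [hc.right_iff (Set.subset_insert _ _) θ (Set.mem_insert _ _)] at hψ
    refine (hT.eventually_swap θ U V (hψ.mono fun y hy => ?_)).mono fun x hx => ?_
    · simpa only [realize_pair_iff] using
        hb.eventually_left subset_rfl θ (Set.mem_range_self y) hy
    · rw [hc.right_iff (Set.subset_insert _ _) θ (Set.mem_insert_of_mem _ (Set.mem_range_self x))]
      simpa only [realize_pair_iff] using hx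
  obtain ⟨θ, hθ⟩ := exists_formula_mul f mul φ
  have hG : ∀ x y : G, θ.Realize (Sum.elim f ![f x, f y]) ↔ x * y ∈ solutionSet φ := fun x y =>
    (hθ _ _).trans (holds_mulIn_iff hmul f φ x y)
  refine ⟨b, c, hb.not_mem_range f.injective subset_rfl hU,
    hc.not_mem_range f.injective (Set.subset_insert _ _) hV, ?_,
    hb'.finitelySatisfiableIn, hc.finitelySatisfiableIn⟩
  rw [← hθ, hc.right_iff (Set.subset_insert _ _) θ (Set.mem_insert _ _)]
  filter_upwards [hVC] with y hy
  rw [hb.left_iff subset_rfl θ (Set.mem_range_self y)]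
  filter_upwards [hUB] with x hx
  exact (hG x y).2 (hBC (Set.mul_mem_mul hx hy))

end Main

end Productset

theorem mainTheorem4 {L : FirstOrder.Language.{u, v}} {G : Type w} [Group G] [L.Structure G]
    (mul : L.Functions 2) (hmul : Productset.IsGroupExpansion mul G)
    {N : Type w'} [L.Structure N] (f : G ↪ₑ[L] N) (hN : Productset.IsSmall L (Set.range f))
    (φ : Productset.FormulaOver L G) :
    (Productset.IsCoheirSubstantial mul f φ →
      Productset.HasProductsetProperty (Productset.solutionSet φ)) ∧
    (Productset.IsStable (L.completeTheory G) →
      (Productset.IsCoheirSubstantial mul f φ ↔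
        Productset.HasProductsetProperty (Productset.solutionSet φ))) :=
  ⟨fun h => h.hasProductsetProperty hmul,
    fun hT => ⟨fun h => h.hasProductsetProperty hmul, fun h => h.isCoheirSubstantial hmul hN hT⟩⟩
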